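/- Let $n\ge 1$, let $\mathbf X=(x_{ij})\in\mathbb R^{n\times p}$ be a (fixed) design matrix with rows $\mathbf x_i'$ and columns $\mathbf x_{(j)}$, and let $\beta^\star\in\mathbb R^p$ have support $\mathcal A=\{j:\beta^\star_j\ne0\}$, $s=|\mathcal A|$. Let $y_1,\dots,y_n$ be independent Bernoulli variables with $\Pr(y_i=1)=\exp(\mathbf x_i'\beta^\star)/(1+\exp(\mathbf x_i'\beta^\star))$. Put $\psi(t)=\log(1+e^t)$, $\ell_n(\beta)=\frac1n\sum_{i}\{-y_i\mathbf x_i'\beta+\psi(\mathbf x_i'\beta)\}$ and $\Sigma(\beta)=\operatorname{diag}\{\psi''(\mathbf x_i'\beta)\}$. The oracle estimator is $\hat\beta^{\rm oracle}=\arg\min_{\beta:\,\beta_{\mathcal A^c}=0}\ell_n(\beta)$. Let $\mathbf X_{\mathcal A}$ be the submatrix of the columns in $\mathcal A$, and assume that $\mathbf X_{\mathcal A}'\Sigma(\beta^\star)\mathbf X_{\mathcal A}$ is invertible. For a matrix $\mathbf U$ let $\|\mathbf U\|_{\ell_\infty}=\max_i\sum_j|u_{ij}|$, and define $$M=\max_j\tfrac1n\|\mathbf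 x_{(j)}\|_2^2,\quad Q_1=\max_{1\le j\le p}\lambda_{\max}\bigl(\tfrac1n\mathbf X_{\mathcal A}'\operatorname{diag}\{|\mathbf x_{(j)}|\}\mathbf X_{\mathcal A}\bigr),\quad Q_2=\bigl\|\bigl(\tfrac1n\mathbf X_{\mathcal A}'\Sigma(\beta^\star)\mathbf X_{\mathcal A}\bigr)^{-1}\bigr\|_{\ell_\infty},$$ $$Q_3=\bigl\|\mathbf X_{\mathcal A^c}'\Sigma(\beta^\star)\mathbf X_{\mathcal A}\bigl(\mathbf X_{\mathcal A}'\Sigma(\beta^\star)\mathbf X_{\mathcal A}\bigr)^{-1}\bigr\|_{\ell_\infty}.$$ Let $\lambda>0$, let $a_1,a_2>0$ and $a>a_2$ be constants, and let $P_\lambda$ be a folded concave penalty on $[0,\infty)$: $P_\lambda$ is nondecreasing and concave with $P_\lambda(0)=0$; it is differentiable on $(0,\infty)$ with (finite) $P_\lambda'(0):=P_\lambda'(0+)\ge a_1\lambda$; $P'_\lambda(t)\ge a_1\lambda$ for $0<t\le a_2\lambda$; and $P_\lambda'(t)=0$ for $t\ge a\lambda$. Let $a_0=\min\{1,a_2\}$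 and assume the minimal signal condition $\min_{j\in\mathcal A}|\beta_j^\star|>(a+1)\lambda$; write $\|\beta^\star_{\mathcal A}\|_{\min}=\min_{j\in\mathcal A}|\beta^\star_j|$. Let $\hat\beta^{\rm initial}$ be any random vector in $\mathbb R^p$ (on the same probability space), and $\delta_0=\Pr(\|\hat\beta^{\rm initial}-\beta^\star\|_{\max}>a_0\lambda)$. The local linear approximation (LLA) algorithm starts from $\hat\beta^{(0)}=\hat\beta^{\rm initial}$ and iterates $\hat\beta^{(m)}\in\arg\min_\beta\,\ell_n(\beta)+\sum_jP_\lambda'(|\hat\beta_j^{(m-1)}|)\,|\beta_j|$, $m\ge1$. Then, with probability at least $1-\delta_0-\delta_1^{\rm logit}-\delta_2^{\rm logit}$, the oracle estimator exists and is unique, and the LLA algorithm initialized by $\hat\beta^{\rm initial}$ converges to it after two iterations: the minimizer in every iteration $m\ge1$ exists and is unique, and $\hat\beta^{(m)}=\hat\beta^{\rm oracle}$ for all $m\ge1$ (so the algorithm reaches the oracle in the first iteration, and the second reproduces it). Here $$\delta_1^{\rm logit}=2s\exp\Bigl(-\frac nM\min\Bigl\{\frac{2}{Q_1^2Q_2^4s^2},\frac{a_1^2\lambda^2}{2(1+2Q_3)^2}\Bigr\}\Bigr)+2(p-s)\exp\Bigl(-\frac{a_1^2n\lambda^2}{2M}\Bigr),$$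 $$\delta_2^{\rm logit}=2s\exp\Bigl(-\frac{n}{MQ_2^2}\min\Bigl\{\frac{2}{Q_1^2Q_2^2s^2},\frac12\bigl(\|\beta^\star_{\mathcal A}\|_{\min}-a\lambda\bigr)^2\Bigr\}\Bigr).$$ -/

import Mathlib

open MeasureTheory ProbabilityTheory Filter Topology

noncomputable section

namespace LLALogistic

/-! ### Folded concave penalties -/

/-- The derivative `P'(t)` of a penalty on `[0, ∞)`, with the convention `P'(0) := P'(0+)`. -/
def penaltyDeriv (P : ℝ → ℝ) (t : ℝ) : ℝ :=
  if 0 < t then deriv P t else limUnder (𝓝[>] (0 : ℝ)) (deriv P)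

/-- `P` (the penalty `P_λ` at the given level `lam`, a function on `[0, ∞)`) is a folded concave
penalty with constants `a₁`, `a₂`, `a`. -/
structure IsFoldedConcavePenalty (a₁ a₂ a lam : ℝ) (P : ℝ → ℝ) : Prop where
  a₁_pos : 0 < a₁
  a₂_pos : 0 < a₂
  a₂_lt_a : a₂ < a
  monotoneOn : MonotoneOn P (Set.Ici 0)
  concaveOn : ConcaveOn ℝ (Set.Ici 0) P
  map_zero : P 0 = 0
  differentiableAt : ∀ t, 0 < t → DifferentiableAt ℝ P t
  /-- `P'(0+)` exists as a real number, and so is the value `P'(0)` of `penaltyDeriv`. -/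
  tendsto_deriv_zero : ∃ d, Tendsto (deriv P) (𝓝[>] (0 : ℝ)) (𝓝 d)
  le_deriv_zero : a₁ * lam ≤ penaltyDeriv P 0
  le_deriv : ∀ t, 0 < t → t ≤ a₂ * lam → a₁ * lam ≤ penaltyDeriv P t
  deriv_eq_zero : ∀ t, a * lam ≤ t → penaltyDeriv P t = 0

/-! ### The local linear approximation (LLA) algorithm and the oracle estimator -/

/-- The weighted `ℓ₁` penalized criterion `ℓ(β) + ∑ⱼ wⱼ |βⱼ|`. -/
def weightedObjective {p : ℕ} (loss : (Fin p → ℝ) → ℝ) (w β : Fin p → ℝ) : ℝ :=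
  loss β + ∑ j, w j * |β j|

/-- `b 0, b 1, b 2, …` is a run of the LLA algorithm started at `init`: each `b (m + 1)` is a
global minimizer of the criterion with weights `wⱼ = P'(|b m j|)`. -/
def IsLLARun {p : ℕ} (loss : (Fin p → ℝ) → ℝ) (P : ℝ → ℝ) (init : Fin p → ℝ)
    (b : ℕ → Fin p → ℝ) : Prop :=
  b 0 = init ∧
    ∀ m β, weightedObjective loss (fun j => penaltyDeriv P |b m j|) (b (m + 1)) ≤
      weightedObjective loss (fun j => penaltyDeriv P |b m j|) β

/-- `b` minimizes the loss among the vectors supported in `A`. -/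
def IsOracle {p : ℕ} (loss : (Fin p → ℝ) → ℝ) (A : Finset (Fin p)) (b : Fin p → ℝ) : Prop :=
  (∀ j, j ∉ A → b j = 0) ∧ ∀ β : Fin p → ℝ, (∀ j, j ∉ A → β j = 0) → loss b ≤ loss β

/-- The oracle estimator for the support set `A` exists and is unique, the LLA algorithm started at
`init` can be carried out, and whichever minimizers it picks, its first iterate is the oracle
estimator and so are all later ones (in particular the second). -/
def LLAConvergesToOracle {p : ℕ} (loss : (Fin p → ℝ) → ℝ) (P : ℝ → ℝ) (A : Finset (Fin p))
    (init : Fin p → ℝ) : Prop :=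
  ∃ b : Fin p → ℝ,
    (IsOracle loss A b ∧ ∀ b', IsOracle loss A b' → b' = b) ∧
    (∃ run, IsLLARun loss P init run) ∧
    ∀ run, IsLLARun loss P init run → ∀ m, 1 ≤ m → run m = b

/-! ### Logistic regression -/

/-- `ψ(t) = log (1 + exp t)`. -/
def psi (t : ℝ) : ℝ := Real.log (1 + Real.exp t)

/-- The negative logistic log-likelihood, scaled by `1 / n`; row `i` of `X` is `xᵢ'`. -/
def logisticLoss {n p : ℕ} (X : Matrix (Fin n) (Fin p) ℝ) (y : Fin n → ℝ) (β : Fin p → ℝ) : ℝ :=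
  (1 / (n : ℝ)) * ∑ i, (-(y i) * X.mulVec β i + psi (X.mulVec β i))

/-- The success probability `exp t / (1 + exp t)`. -/
def logisticProb (t : ℝ) : unitInterval :=
  ⟨Real.exp t / (1 + Real.exp t), by positivity,
    (div_le_one (by positivity)).2 (by linarith)⟩

/-- For the fixed design `X`, the responses are independent and `yᵢ` is Bernoulli with success
probability `exp(xᵢ'β) / (1 + exp(xᵢ'β))`. -/
structure IsLogisticModel {Ω : Type*} [MeasurableSpace Ω] (μ : Measure Ω) {n p : ℕ}
    (X : Matrix (Fin n) (Fin p) ℝ) (β : Fin p → ℝ) (y : Fin n → Ω → ℝ) : Prop where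
  measurable : ∀ i, Measurable (y i)
  indep : iIndepFun y μ
  law : ∀ i, μ.map (y i) = bernoulliMeasure (1 : ℝ) 0 (logisticProb (X.mulVec β i))

/-! ### The quantities in the probability bound -/

/-- The support `{j | βⱼ ≠ 0}`. -/
def support {p : ℕ} (β : Fin p → ℝ) : Finset (Fin p) := Finset.univ.filter fun j => β j ≠ 0

/-- `‖β_A‖_min`, the smallest absolute value of an entry of `β` on its support. -/
def minSignal {p : ℕ} (β : Fin p → ℝ) : ℝ := ⨅ j : support β, |β j|

/-- The columns of `X` with index in `A`. -/
def cols {n p : ℕ} (X : Matrix (Fin n) (Fin p) ℝ) (A : Finset (Fin p)) : Matrix (Fin n) A ℝ :=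
  X.submatrix id Subtype.val

/-- `Σ(β) = diag(ψ''(xᵢ'β))`. -/
def sigmaMat {n p : ℕ} (X : Matrix (Fin n) (Fin p) ℝ) (β : Fin p → ℝ) :
    Matrix (Fin n) (Fin n) ℝ :=
  Matrix.diagonal fun i => deriv (deriv psi) (X.mulVec β i)

/-- `X_A' Σ(β) X_A`, with `A` the support of `β`. -/
def gramA {n p : ℕ} (X : Matrix (Fin n) (Fin p) ℝ) (β : Fin p → ℝ) :
    Matrix (support β) (support β) ℝ :=
  (cols X (support β)).transpose * sigmaMat X β * cols X (support β)

/-- The largest (real) eigenvalue; used for symmetric matrices only. -/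
def lambdaMax {ι : Type*} [Fintype ι] [DecidableEq ι] (B : Matrix ι ι ℝ) : ℝ :=
  sSup (spectrum ℝ B)

/-- The matrix norm `‖B‖_{ℓ∞} = maxᵢ ∑ⱼ |bᵢⱼ|`. -/
def linftyNorm {ι κ : Type*} [Fintype ι] [Fintype κ] (B : Matrix ι κ ℝ) : ℝ :=
  letI : NormedAddCommGroup (Matrix ι κ ℝ) := Matrix.linftyOpNormedAddCommGroup
  ‖B‖

/-- `M = maxⱼ n⁻¹ ‖x₍ⱼ₎‖²`. -/
def colBound {n p : ℕ} (X : Matrix (Fin n) (Fin p) ℝ) : ℝ :=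
  ⨆ j : Fin p, (1 / (n : ℝ)) * ∑ i, X i j ^ 2

/-- `Q₁ = maxⱼ λ_max(n⁻¹ X_A' diag(|x₍ⱼ₎|) X_A)`, the maximum over all columns `j`. -/
def Q₁ {n p : ℕ} (X : Matrix (Fin n) (Fin p) ℝ) (β : Fin p → ℝ) : ℝ :=
  ⨆ j : Fin p, lambdaMax ((1 / (n : ℝ)) •
    ((cols X (support β)).transpose * Matrix.diagonal (fun i => |X i j|) * cols X (support β)))

/-- `Q₂ = ‖(n⁻¹ X_A' Σ(β) X_A)⁻¹‖_{ℓ∞}`. -/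
def Q₂ {n p : ℕ} (X : Matrix (Fin n) (Fin p) ℝ) (β : Fin p → ℝ) : ℝ :=
  linftyNorm ((1 / (n : ℝ)) • gramA X β)⁻¹

/-- `Q₃ = ‖X_{Aᶜ}' Σ(β) X_A (X_A' Σ(β) X_A)⁻¹‖_{ℓ∞}`. -/
def Q₃ {n p : ℕ} (X : Matrix (Fin n) (Fin p) ℝ) (β : Fin p → ℝ) : ℝ :=
  linftyNorm ((cols X (support β)ᶜ).transpose * sigmaMat X β * cols X (support β) *
    (gramA X β)⁻¹)

/-- `δ₁^logit`. -/
def delta₁ {n p : ℕ} (X : Matrix (Fin n) (Fin p) ℝ) (β : Fin p → ℝ) (a₁ lam : ℝ) : ℝ :=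
  2 * ((support β).card : ℝ) *
      Real.exp (-((n : ℝ) / colBound X) *
        min (2 / (Q₁ X β ^ 2 * Q₂ X β ^ 4 * ((support β).card : ℝ) ^ 2))
          (a₁ ^ 2 * lam ^ 2 / (2 * (1 + 2 * Q₃ X β) ^ 2))) +
    2 * ((p : ℝ) - ((support β).card : ℝ)) *
      Real.exp (-(a₁ ^ 2 * (n : ℝ) * lam ^ 2 / (2 * colBound X)))

/-- `δ₂^logit`. -/
def delta₂ {n p : ℕ} (X : Matrix (Fin n) (Fin p) ℝ) (β : Fin p → ℝ) (a lam : ℝ) : ℝ :=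
  2 * ((support β).card : ℝ) *
    Real.exp (-((n : ℝ) / (colBound X * Q₂ X β ^ 2)) *
      min (2 / (Q₁ X β ^ 2 * Q₂ X β ^ 2 * ((support β).card : ℝ) ^ 2))
        (1 / 2 * (minSignal β - a * lam) ^ 2))

end LLALogistic

end

namespace LLALogistic

/-! ### The logistic link -/

/-! Everything reduces to the gradient of the loss at `βstar`. Suppose its entries are at most `t`
on the support `A` and at most `a₁ * lam / 2` off it. Expand the gradient to first order at `βstar`
along vectors supported in `A`: the linear part is the Hessian, and the remainder is quadratic,
controlled by `Q₁`. When `t` is small, Banach's fixed point theorem (`exists_small_root`) gives a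
point `b` supported in `A`, within `2 * Q₂ * t` of `βstar` in sup norm, whose gradient vanishes on
`A`; through `Q₃` its gradient off `A` stays below `a₁ * lam` (`exists_stationary`).

By convexity such a `b` is the unique minimizer for any weights that vanish on `A` and exceed the
gradient of `b` off `A` (`weightedObjective_lt`). The folded concave penalty produces such weights
both at the initial estimator and at `b`, by the minimal signal condition, so the first step lands
on `b` and every later step stays there. The same inequality, restricted to vectors supported in
`A`, shows that `b` is the oracle.

For the probability, each gradient entry at `βstar` is an average of independent centred bounded
variables, so Hoeffding's bound and a union bound apply. The level `t` is the smallest of three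
requirements (contraction, gradient off `A`, signal strength), and `exists_threshold` matches the
resulting tail with `δ₁` and `δ₂`. -/

lemma hasDerivAt_psi (t : ℝ) : HasDerivAt psi (Real.sigmoid t) t := by
  have h : HasDerivAt psi (Real.exp t / (1 + Real.exp t)) t :=
    ((Real.hasDerivAt_exp t).const_add 1).log (by positivity)
  convert h using 1
  rw [Real.sigmoid_def, Real.exp_neg]
  field_simp
  ring

lemma deriv_psi : deriv psi = Real.sigmoid := funext fun t => (hasDerivAt_psi t).deriv

lemma deriv_deriv_psi (t : ℝ) :
    deriv (deriv psi) t = Real.sigmoid t * (1 - Real.sigmoid t) := by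
  rw [deriv_psi, Real.deriv_sigmoid]

lemma coe_logisticProb (t : ℝ) : (logisticProb t : ℝ) = Real.sigmoid t := by
  have : (logisticProb t : ℝ) = Real.exp t / (1 + Real.exp t) := rfl
  rw [this, Real.sigmoid_def, Real.exp_neg]
  field_simp
  ring

/-- Strict convexity: by the mean value theorem the slope of the chord is `Real.sigmoid` at an
intermediate point, and `Real.sigmoid` is strictly increasing. -/
lemma psi_tangent_lt {u v : ℝ} (h : u ≠ v) :
    psi v + Real.sigmoid v * (u - v) < psi u := by
  have hc : Continuous psi := continuous_iff_continuousAt.2 fun t => (hasDerivAt_psi t).continuousAt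
  rcases lt_or_gt_of_ne h with h | h
  · obtain ⟨c, hc1, hc2⟩ := exists_hasDerivAt_eq_slope psi Real.sigmoid h hc.continuousOn
      fun x _ => hasDerivAt_psi x
    have hs := Real.sigmoid_strictMono hc1.2
    rw [hc2, div_lt_iff₀ (by linarith)] at hs
    linarith
  · obtain ⟨c, hc1, hc2⟩ := exists_hasDerivAt_eq_slope psi Real.sigmoid h hc.continuousOn
      fun x _ => hasDerivAt_psi x
    have hs := Real.sigmoid_strictMono hc1.1
    rw [hc2, lt_div_iff₀ (by linarith)] at hs
    linarith

lemma psi_tangent_le (u v : ℝ) : psi v + Real.sigmoid v * (u - v) ≤ psi u := by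
  rcases eq_or_ne u v with rfl | h
  · simp
  · exact (psi_tangent_lt h).le

/-- `ψ''` is Lipschitz with constant `1 / 8`. -/
lemma abs_sigmoidDeriv_sub_le (s t : ℝ) :
    |Real.sigmoid s * (1 - Real.sigmoid s) - Real.sigmoid t * (1 - Real.sigmoid t)| ≤
      1 / 8 * |s - t| := by
  have hd : ∀ x : ℝ, HasDerivAt (fun x => Real.sigmoid x * (1 - Real.sigmoid x))
      (Real.sigmoid x * (1 - Real.sigmoid x) * (1 - 2 * Real.sigmoid x)) x := fun x => by
    have h := Real.hasDerivAt_sigmoid x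
    refine (h.mul (h.const_sub 1)).congr_deriv ?_
    ring
  have hb : ∀ x : ℝ,
      ‖Real.sigmoid x * (1 - Real.sigmoid x) * (1 - 2 * Real.sigmoid x)‖ ≤ 1 / 8 := fun x => by
    have h0 := Real.sigmoid_nonneg x
    have h1 := Real.sigmoid_le_one x
    set z := Real.sigmoid x
    have h2 : 0 ≤ z * (1 - z) := mul_nonneg h0 (by linarith)
    have h3 : z * (1 - z) ≤ 1 / 4 := by nlinarith [sq_nonneg (1 - 2 * z)]
    rw [Real.norm_eq_abs]
    refine abs_le_of_sq_le_sq ?_ (by norm_num)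
    -- With `v = z * (1 - z)` the squared third derivative of `psi` is `v ^ 2 * (1 - 4 * v)`, which
    -- on `[0, 1/4]` peaks at `v = 1/6` with value `1/108 < 1/64`.
    have h4 : (z * (1 - z) * (1 - 2 * z)) ^ 2
        = (z * (1 - z)) ^ 2 * (1 - 4 * (z * (1 - z))) := by ring
    rw [h4]
    generalize z * (1 - z) = v at *
    nlinarith [mul_nonneg h2 (sq_nonneg (v - 1 / 6)), sq_nonneg (v - 1 / 6)]
  simpa using convex_univ.norm_image_sub_le_of_norm_hasDerivWithin_le
    (fun x _ => (hd x).hasDerivWithinAt) (fun x _ => hb x) (Set.mem_univ t) (Set.mem_univ s)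

/-- The remainder of the first order expansion of `ψ'` at `η`. -/
noncomputable def sigmoidRem (η d : ℝ) : ℝ :=
  Real.sigmoid (η + d) - Real.sigmoid η - Real.sigmoid η * (1 - Real.sigmoid η) * d

lemma sigmoidRem_zero (η : ℝ) : sigmoidRem η 0 = 0 := by simp [sigmoidRem]

/-- The derivative of the remainder at `x` is a difference of values of `ψ''` at distance `|x|`,
hence at most `|x| / 8`, and `|x| ≤ |d| + |e|` between `d` and `e`. The factor `|d| + |e|` is what
makes the remainder contractive near zero. -/
lemma abs_sigmoidRem_sub_le (η d e : ℝ) :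
    |sigmoidRem η d - sigmoidRem η e| ≤ 1 / 8 * (|d| + |e|) * |d - e| := by
  have hd : ∀ x : ℝ, HasDerivAt (sigmoidRem η) (Real.sigmoid (η + x) * (1 - Real.sigmoid (η + x)) -
      Real.sigmoid η * (1 - Real.sigmoid η)) x := fun x => by
    have h := (Real.hasDerivAt_sigmoid (η + x)).comp_const_add η x
    exact ((h.sub_const (Real.sigmoid η)).sub
      ((hasDerivAt_id' x).const_mul (Real.sigmoid η * (1 - Real.sigmoid η)))).congr_deriv
      (by rw [mul_one])
  refine (convex_uIcc e d).norm_image_sub_le_of_norm_hasDerivWithin_le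
    (fun x _ => (hd x).hasDerivWithinAt) (fun x hx => ?_) Set.left_mem_uIcc Set.right_mem_uIcc
  refine (abs_sigmoidDeriv_sub_le _ _).trans ?_
  rw [add_sub_cancel_left]
  gcongr
  rw [Set.mem_uIcc] at hx
  rw [abs_le]
  have := neg_abs_le d
  have := neg_abs_le e
  have := le_abs_self d
  have := le_abs_self e
  rcases hx with hx | hx <;> constructor <;> linarith [hx.1, hx.2]

/-! ### Matrix bounds -/

lemma abs_mulVec_le_linftyNorm {ι κ : Type*} [Fintype ι] [Fintype κ] (B : Matrix ι κ ℝ)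
    {v : κ → ℝ} {c : ℝ} (hc : 0 ≤ c) (hv : ∀ k, |v k| ≤ c) (i : ι) :
    |B.mulVec v i| ≤ linftyNorm B * c := by
  let _ : NormedAddCommGroup (Matrix ι κ ℝ) := Matrix.linftyOpNormedAddCommGroup
  have h1 : ‖B.mulVec v‖ ≤ ‖B‖ * ‖v‖ := Matrix.linfty_opNorm_mulVec B v
  have h2 : ‖v‖ ≤ c := (pi_norm_le_iff_of_nonneg hc).2 hv
  exact (norm_le_pi_norm (B.mulVec v) i).trans
    (h1.trans (mul_le_mul_of_nonneg_left h2 (norm_nonneg B)))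

lemma linftyNorm_nonneg {ι κ : Type*} [Fintype ι] [Fintype κ] (B : Matrix ι κ ℝ) :
    0 ≤ linftyNorm B := by
  let _ : NormedAddCommGroup (Matrix ι κ ℝ) := Matrix.linftyOpNormedAddCommGroup
  exact norm_nonneg B

/-- The matrix `lambdaMax B • 1 - B` is Hermitian with spectrum `lambdaMax B - spectrum B`, which is
nonnegative, so it is positive semidefinite. -/
lemma dotProduct_mulVec_le_lambdaMax {ι : Type*} [Fintype ι] [DecidableEq ι] {B : Matrix ι ι ℝ}
    (hB : B.IsHermitian) (v : ι → ℝ) :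
    v ⬝ᵥ B.mulVec v ≤ lambdaMax B * (v ⬝ᵥ v) := by
  have h : ((algebraMap ℝ (Matrix ι ι ℝ)) (lambdaMax B) - B).PosSemidef := by
    rw [Matrix.posSemidef_iff_isHermitian_and_spectrum_nonneg]
    refine ⟨?_, ?_⟩
    · refine Matrix.IsHermitian.sub ?_ hB
      rw [Matrix.algebraMap_eq_diagonal]
      exact Matrix.isHermitian_diagonal _
    · rw [← spectrum.singleton_sub_eq]
      rintro _ ⟨x, hx, z, hz, rfl⟩
      rw [Set.mem_singleton_iff] at hx
      subst hx
      have : z ≤ lambdaMax B := le_csSup B.finite_real_spectrum.bddAbove hz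
      simpa using this
  have h2 := h.dotProduct_mulVec_nonneg v
  rw [Matrix.sub_mulVec, dotProduct_sub, Algebra.algebraMap_eq_smul_one, Matrix.smul_mulVec,
    Matrix.one_mulVec, dotProduct_smul] at h2
  simpa using h2

lemma lambdaMax_nonneg {ι : Type*} [Fintype ι] [DecidableEq ι] {B : Matrix ι ι ℝ}
    (hB : B.PosSemidef) : 0 ≤ lambdaMax B :=
  Real.sSup_nonneg fun _ hx =>
    (Matrix.posSemidef_iff_isHermitian_and_spectrum_nonneg.1 hB).2 hx

/-- A perturbed linear system `g + H u + R u = 0` has a small solution when `H⁻¹ R` is a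
contraction. -/
lemma exists_small_root {ι : Type*} [Fintype ι] [DecidableEq ι] {H : Matrix ι ι ℝ} (hH : IsUnit H)
    {g : ι → ℝ} {R : (ι → ℝ) → ι → ℝ} {t L : ℝ} (ht : 0 ≤ t) (hg : ∀ i, |g i| ≤ t) (hR0 : R 0 = 0)
    (hL : linftyNorm H⁻¹ * L ≤ 1 / 2) (hL0 : 0 ≤ L)
    (hR : ∀ u v, ‖u‖ ≤ 2 * linftyNorm H⁻¹ * t → ‖v‖ ≤ 2 * linftyNorm H⁻¹ * t →
      ∀ i, |R u i - R v i| ≤ L * ‖u - v‖) :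
    ∃ u : ι → ℝ, ‖u‖ ≤ 2 * linftyNorm H⁻¹ * t ∧ g + H.mulVec u + R u = 0 := by
  set q := linftyNorm H⁻¹ with hq
  have hq0 : 0 ≤ q := linftyNorm_nonneg _
  -- Roots are the fixed points of `F`. It is `1/2`-Lipschitz on the ball of radius `2 * q * t` and
  -- `‖F 0‖ ≤ q * t`, so it maps that ball to itself.
  set F : (ι → ℝ) → ι → ℝ := fun u => -(H⁻¹).mulVec (g + R u) with hF
  have hFsub : ∀ u v, ‖u‖ ≤ 2 * q * t → ‖v‖ ≤ 2 * q * t → ‖F u - F v‖ ≤ 1 / 2 * ‖u - v‖ := by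
    intro u v hu hv
    have h1 : F u - F v = (H⁻¹).mulVec (R v - R u) := by
      simp only [hF]
      rw [neg_sub_neg, ← Matrix.mulVec_sub, add_sub_add_left_eq_sub]
    rw [h1, pi_norm_le_iff_of_nonneg (by positivity)]
    intro i
    refine (abs_mulVec_le_linftyNorm _ (c := L * ‖u - v‖) (by positivity)
      (fun k => by simpa [abs_sub_comm] using hR u v hu hv k) i).trans ?_
    rw [← mul_assoc]
    gcongr
  have hF0 : ‖F 0‖ ≤ q * t := by
    rw [pi_norm_le_iff_of_nonneg (by positivity)]
    intro i
    simp only [hF, hR0, add_zero, Pi.neg_apply, norm_neg]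
    exact abs_mulVec_le_linftyNorm _ ht hg i
  have hmaps : Set.MapsTo F (Metric.closedBall 0 (2 * q * t)) (Metric.closedBall 0 (2 * q * t)) := by
    intro u hu
    rw [mem_closedBall_zero_iff] at hu ⊢
    have h := hFsub u 0 hu (by simp; positivity)
    rw [sub_zero] at h
    have : ‖F u‖ ≤ ‖F u - F 0‖ + ‖F 0‖ := by simpa using norm_add_le (F u - F 0) (F 0)
    linarith
  have hcontr : ContractingWith (1 / 2) (hmaps.restrict F _ _) := by
    refine ⟨by norm_num, LipschitzWith.of_dist_le_mul fun u v => ?_⟩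
    rw [Subtype.dist_eq, Subtype.dist_eq, dist_eq_norm, dist_eq_norm]
    simpa using hFsub u v (mem_closedBall_zero_iff.1 u.2) (mem_closedBall_zero_iff.1 v.2)
  obtain ⟨u, hu, hfix, -⟩ := hcontr.exists_fixedPoint' Metric.isClosed_closedBall.isComplete hmaps
    (x := 0) (by simp; positivity) (edist_ne_top _ _)
  refine ⟨u, by simpa using hu, ?_⟩
  have h1 : H.mulVec u = -(g + R u) := by
    conv_lhs => rw [← hfix.eq]
    simp only [hF]
    rw [Matrix.mulVec_neg, Matrix.mulVec_mulVec,
      Matrix.mul_nonsing_inv _ ((Matrix.isUnit_iff_isUnit_det _).1 hH), Matrix.one_mulVec]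
  rw [h1]
  abel

variable {n p : ℕ}

/-! ### The gradient of the logistic loss -/

/-- The gradient of the logistic loss. -/
noncomputable def grad (X : Matrix (Fin n) (Fin p) ℝ) (y : Fin n → ℝ) (β : Fin p → ℝ) (j : Fin p) :
    ℝ :=
  (1 / (n : ℝ)) * ∑ i, X i j * (Real.sigmoid (X.mulVec β i) - y i)

lemma sum_grad_mul (X : Matrix (Fin n) (Fin p) ℝ) (y : Fin n → ℝ) (b v : Fin p → ℝ) :
    ∑ j, grad X y b j * v j =
      (1 / (n : ℝ)) * ∑ i, (Real.sigmoid (X.mulVec b i) - y i) * X.mulVec v i := by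
  simp only [grad, Matrix.mulVec, dotProduct, Finset.mul_sum, Finset.sum_mul]
  rw [Finset.sum_comm]
  exact Finset.sum_congr rfl fun i _ => Finset.sum_congr rfl fun j _ => by ring

/-- The part of the loss that involves `y` is linear and cancels, so the gap to the tangent plane is
an average of the gaps of `psi`. -/
lemma logisticLoss_sub (X : Matrix (Fin n) (Fin p) ℝ) (y : Fin n → ℝ) (b β : Fin p → ℝ) :
    logisticLoss X y β - (logisticLoss X y b + ∑ j, grad X y b j * (β j - b j)) =
      (1 / (n : ℝ)) * ∑ i, (psi (X.mulVec β i) -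
        (psi (X.mulVec b i) + Real.sigmoid (X.mulVec b i) * (X.mulVec β i - X.mulVec b i))) := by
  have h := sum_grad_mul X y b (β - b)
  simp only [Pi.sub_apply, Matrix.mulVec_sub] at h
  rw [h, logisticLoss, logisticLoss, ← mul_add, ← mul_sub, ← Finset.sum_add_distrib,
    ← Finset.sum_sub_distrib]
  congr 1
  exact Finset.sum_congr rfl fun i _ => by ring

lemma logisticLoss_tangent_le (X : Matrix (Fin n) (Fin p) ℝ) (y : Fin n → ℝ) (b β : Fin p → ℝ) :
    logisticLoss X y b + ∑ j, grad X y b j * (β j - b j) ≤ logisticLoss X y β := by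
  rw [← sub_nonneg, logisticLoss_sub]
  exact mul_nonneg (by positivity)
    (Finset.sum_nonneg fun i _ => sub_nonneg.2 (psi_tangent_le _ _))

lemma logisticLoss_tangent_lt (hn : 0 < n) (X : Matrix (Fin n) (Fin p) ℝ) (y : Fin n → ℝ)
    {b β : Fin p → ℝ} (h : X.mulVec β ≠ X.mulVec b) :
    logisticLoss X y b + ∑ j, grad X y b j * (β j - b j) < logisticLoss X y β := by
  rw [← sub_pos, logisticLoss_sub]
  obtain ⟨i, hi⟩ := Function.ne_iff.1 h
  exact mul_pos (by positivity) (Finset.sum_pos' (fun i _ => sub_nonneg.2 (psi_tangent_le _ _))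
    ⟨i, Finset.mem_univ _, sub_pos.2 (psi_tangent_lt hi)⟩)

/-! ### Vectors supported in `A` -/

/-- Extension by zero of a vector indexed by `A`. -/
def extendZero (A : Finset (Fin p)) (u : A → ℝ) (j : Fin p) : ℝ :=
  if h : j ∈ A then u ⟨j, h⟩ else 0

lemma mulVec_extendZero (X : Matrix (Fin n) (Fin p) ℝ) (A : Finset (Fin p)) (u : A → ℝ) :
    X.mulVec (extendZero A u) = (cols X A).mulVec u := by
  ext i
  simp only [Matrix.mulVec, dotProduct, cols, Matrix.submatrix_apply, id]
  rw [← Finset.sum_subset (Finset.subset_univ A) (fun j _ hj => by simp [extendZero, hj]),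
    ← Finset.sum_coe_sort]
  exact Finset.sum_congr rfl fun k _ => by simp [extendZero]

lemma extendZero_restrict {A : Finset (Fin p)} {v : Fin p → ℝ} (hv : ∀ j, j ∉ A → v j = 0) :
    extendZero A (fun k => v k) = v := by
  ext j
  by_cases h : j ∈ A <;> simp [extendZero, h, hv]

/-- The source of uniqueness: on vectors supported in the support of `βstar`, different coefficients
give different linear predictors. -/
lemma cols_mulVec_injective {X : Matrix (Fin n) (Fin p) ℝ} {βstar : Fin p → ℝ}
    (hX : IsUnit (gramA X βstar)) {u : support βstar → ℝ}
    (hu : (cols X (support βstar)).mulVec u = 0) : u = 0 := by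
  have h : (gramA X βstar).mulVec u = 0 := by
    rw [gramA, ← Matrix.mulVec_mulVec, hu, Matrix.mulVec_zero]
  have h2 := congrArg ((gramA X βstar)⁻¹).mulVec h
  rwa [Matrix.mulVec_mulVec, Matrix.nonsing_inv_mul _ ((Matrix.isUnit_iff_isUnit_det _).1 hX),
    Matrix.one_mulVec, Matrix.mulVec_zero] at h2

/-- A vector satisfying the strict first order conditions is the unique minimizer of the weighted
`ℓ₁` penalized loss. -/
lemma weightedObjective_lt (hn : 0 < n) {X : Matrix (Fin n) (Fin p) ℝ} {βstar : Fin p → ℝ}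
    (hX : IsUnit (gramA X βstar)) (y : Fin n → ℝ) {b w : Fin p → ℝ}
    (hb : ∀ j, j ∉ support βstar → b j = 0) (hg : ∀ j ∈ support βstar, grad X y b j = 0)
    (hw : ∀ j ∈ support βstar, w j = 0) (hgw : ∀ j, j ∉ support βstar → |grad X y b j| < w j)
    {β : Fin p → ℝ} (hβ : β ≠ b) :
    weightedObjective (logisticLoss X y) w b < weightedObjective (logisticLoss X y) w β := by
  have hwb : ∑ j, w j * |b j| = 0 := Finset.sum_eq_zero fun j _ => by
    by_cases h : j ∈ support βstar
    · simp [hw j h]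
    · simp [hb j h]
  have hterm : ∀ j, 0 ≤ grad X y b j * (β j - b j) + w j * |β j| := fun j => by
    by_cases h : j ∈ support βstar
    · simp [hg j h, hw j h]
    · rw [hb j h, sub_zero]
      have h1 := neg_abs_le (grad X y b j * β j)
      rw [abs_mul] at h1
      have h2 := mul_le_mul_of_nonneg_right (hgw j h).le (abs_nonneg (β j))
      linarith
  have hsum : ∑ j, (grad X y b j * (β j - b j) + w j * |β j|) =
      ∑ j, grad X y b j * (β j - b j) + ∑ j, w j * |β j| := Finset.sum_add_distrib
  have hnn := Finset.sum_nonneg fun j (_ : j ∈ Finset.univ) => hterm j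
  unfold weightedObjective
  -- Strictness has two sources: a nonzero coordinate off the support pays more in weight than it
  -- gains in gradient; otherwise the linear predictors differ and the loss lies strictly above its
  -- tangent plane.
  by_cases hs : ∃ j, j ∉ support βstar ∧ β j ≠ 0
  · obtain ⟨j, hj, hβj⟩ := hs
    have hpos : 0 < ∑ j, (grad X y b j * (β j - b j) + w j * |β j|) := by
      refine Finset.sum_pos' (fun j _ => hterm j) ⟨j, Finset.mem_univ _, ?_⟩
      rw [hb j hj, sub_zero]
      have h1 := neg_abs_le (grad X y b j * β j)
      rw [abs_mul] at h1
      have h2 := mul_lt_mul_of_pos_right (hgw j hj) (abs_pos.2 hβj)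
      linarith
    have := logisticLoss_tangent_le X y b β
    linarith
  · push Not at hs
    have hne : X.mulVec β ≠ X.mulVec b := fun h => by
      have hsupp : ∀ j, j ∉ support βstar → (β - b) j = 0 := fun j hj => by
        simp [hs j hj, hb j hj]
      have h0 : X.mulVec (β - b) = 0 := by rw [Matrix.mulVec_sub, h, sub_self]
      rw [← extendZero_restrict hsupp, mulVec_extendZero] at h0
      have h1 := extendZero_restrict hsupp
      rw [cols_mulVec_injective hX h0] at h1
      refine hβ (sub_eq_zero.1 (h1.symm.trans ?_))
      ext j
      simp [extendZero]
    have := logisticLoss_tangent_lt hn X y hne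
    linarith

/-! ### The remainder of the gradient -/

/-- The remainder of the first order expansion of the gradient at `β` along vectors supported
in `A`. -/
noncomputable def gradRem (X : Matrix (Fin n) (Fin p) ℝ) (β : Fin p → ℝ) (A : Finset (Fin p))
    (u : A → ℝ) (j : Fin p) : ℝ :=
  (1 / (n : ℝ)) * ∑ i, X i j * sigmoidRem (X.mulVec β i) ((cols X A).mulVec u i)

lemma grad_add_extendZero (X : Matrix (Fin n) (Fin p) ℝ) (y : Fin n → ℝ) (β : Fin p → ℝ)
    (A : Finset (Fin p)) (u : A → ℝ) (j : Fin p) :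
    grad X y (β + extendZero A u) j = grad X y β j +
      (1 / (n : ℝ)) * ∑ i, X i j * (deriv (deriv psi) (X.mulVec β i) * (cols X A).mulVec u i) +
      gradRem X β A u j := by
  simp only [grad, gradRem, sigmoidRem, deriv_deriv_psi, Matrix.mulVec_add, mulVec_extendZero,
    Pi.add_apply]
  rw [← mul_add, ← mul_add, ← Finset.sum_add_distrib, ← Finset.sum_add_distrib]
  congr 1
  exact Finset.sum_congr rfl fun i _ => by ring

lemma quadForm_posSemidef (X : Matrix (Fin n) (Fin p) ℝ) (A : Finset (Fin p)) (j : Fin p) :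
    ((1 / (n : ℝ)) • ((cols X A).transpose * Matrix.diagonal (fun i => |X i j|) *
      cols X A)).PosSemidef := by
  refine Matrix.PosSemidef.smul ?_ (by positivity)
  have h : (Matrix.diagonal fun i => |X i j|).PosSemidef :=
    Matrix.PosSemidef.diagonal fun i => abs_nonneg _
  simpa using h.conjTranspose_mul_mul_same (cols X A)

lemma Q₁_nonneg (X : Matrix (Fin n) (Fin p) ℝ) (β : Fin p → ℝ) : 0 ≤ Q₁ X β :=
  Real.iSup_nonneg fun j => lambdaMax_nonneg (quadForm_posSemidef X _ j)

/-- The eigenvalue bound is Euclidean while the fixed point argument uses the sup norm; the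
conversion costs the factor `(support β).card`. -/
lemma quadForm_le (X : Matrix (Fin n) (Fin p) ℝ) (β : Fin p → ℝ) (j : Fin p)
    (w : support β → ℝ) :
    (1 / (n : ℝ)) * ∑ i, |X i j| * (cols X (support β)).mulVec w i ^ 2 ≤
      Q₁ X β * (support β).card * ‖w‖ ^ 2 := by
  have h1 := dotProduct_mulVec_le_lambdaMax (quadForm_posSemidef X (support β) j).1 w
  have h2 : w ⬝ᵥ ((1 / (n : ℝ)) • ((cols X (support β)).transpose *
      Matrix.diagonal (fun i => |X i j|) * cols X (support β))).mulVec w =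
      (1 / (n : ℝ)) * ∑ i, |X i j| * (cols X (support β)).mulVec w i ^ 2 := by
    rw [Matrix.smul_mulVec, dotProduct_smul, smul_eq_mul, ← Matrix.mulVec_mulVec,
      ← Matrix.mulVec_mulVec, Matrix.dotProduct_mulVec, Matrix.vecMul_transpose]
    congr 1
    exact Finset.sum_congr rfl fun i _ => by rw [Matrix.mulVec_diagonal]; ring
  rw [h2] at h1
  have h3 : w ⬝ᵥ w ≤ (support β).card * ‖w‖ ^ 2 := by
    have : ∀ k ∈ (Finset.univ : Finset (support β)), w k * w k ≤ ‖w‖ ^ 2 := fun k _ => by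
      rw [← pow_two, ← sq_abs]
      exact pow_le_pow_left₀ (abs_nonneg _) (norm_le_pi_norm w k) 2
    simpa [dotProduct] using Finset.sum_le_card_nsmul _ _ _ this
  have h4 : 0 ≤ w ⬝ᵥ w := Finset.sum_nonneg fun k _ => mul_self_nonneg _
  have h5 : lambdaMax ((1 / (n : ℝ)) • ((cols X (support β)).transpose *
      Matrix.diagonal (fun i => |X i j|) * cols X (support β))) ≤ Q₁ X β :=
    le_ciSup (f := fun j : Fin p => lambdaMax ((1 / (n : ℝ)) • ((cols X (support β)).transpose *
      Matrix.diagonal (fun i => |X i j|) * cols X (support β)))) (Finite.bddAbove_range _) j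
  calc _ ≤ _ := h1
    _ ≤ Q₁ X β * (w ⬝ᵥ w) := mul_le_mul_of_nonneg_right h5 h4
    _ ≤ Q₁ X β * ((support β).card * ‖w‖ ^ 2) := mul_le_mul_of_nonneg_left h3 (Q₁_nonneg X β)
    _ = _ := by ring

/-- Cauchy–Schwarz with weights `|X i j|`, applied to `quadForm_le`. -/
lemma bilinForm_le (X : Matrix (Fin n) (Fin p) ℝ) (β : Fin p → ℝ) (j : Fin p)
    (v w : support β → ℝ) :
    (1 / (n : ℝ)) * ∑ i, |X i j| * (|(cols X (support β)).mulVec v i| *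
      |(cols X (support β)).mulVec w i|) ≤ Q₁ X β * (support β).card * (‖v‖ * ‖w‖) := by
  have hQ := Q₁_nonneg X β
  have hcs := Finset.sum_sq_le_sum_mul_sum_of_sq_le_mul Finset.univ
    (f := fun i => |X i j| * (cols X (support β)).mulVec v i ^ 2)
    (g := fun i => |X i j| * (cols X (support β)).mulVec w i ^ 2)
    (r := fun i => |X i j| * (|(cols X (support β)).mulVec v i| *
      |(cols X (support β)).mulVec w i|))
    (fun i _ => by positivity) (fun i _ => by positivity)
    (fun i _ => le_of_eq (by
      rw [mul_pow, mul_pow, sq_abs (Matrix.mulVec _ v i), sq_abs (Matrix.mulVec _ w i)]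
      ring))
  refine (abs_le_of_sq_le_sq' ?_ (by positivity)).2
  calc _ ≤ ((1 / (n : ℝ)) * ∑ i, |X i j| * (cols X (support β)).mulVec v i ^ 2) *
        ((1 / (n : ℝ)) * ∑ i, |X i j| * (cols X (support β)).mulVec w i ^ 2) := by
        rw [mul_pow, mul_mul_mul_comm, ← pow_two]
        exact mul_le_mul_of_nonneg_left hcs (by positivity)
    _ ≤ (Q₁ X β * (support β).card * ‖v‖ ^ 2) * (Q₁ X β * (support β).card * ‖w‖ ^ 2) :=
        mul_le_mul (quadForm_le X β j v) (quadForm_le X β j w) (by positivity) (by positivity)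
    _ = _ := by ring

/-- Used twice: on a small ball it gives the contraction constant, and with `v = 0` it shows that
the remainder is quadratic in `‖u‖`. Since `j` ranges over all columns, it serves off the support
too. -/
lemma abs_gradRem_sub_le (X : Matrix (Fin n) (Fin p) ℝ) (β : Fin p → ℝ) (j : Fin p)
    (u v : support β → ℝ) :
    |gradRem X β (support β) u j - gradRem X β (support β) v j| ≤
      1 / 8 * (Q₁ X β * (support β).card) * (‖u‖ + ‖v‖) * ‖u - v‖ := by
  have h1 := bilinForm_le X β j u (u - v)
  have h2 := bilinForm_le X β j v (u - v)
  set Z := cols X (support β)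
  calc |gradRem X β (support β) u j - gradRem X β (support β) v j|
      = (1 / (n : ℝ)) * |∑ i, X i j * (sigmoidRem (X.mulVec β i) (Z.mulVec u i) -
          sigmoidRem (X.mulVec β i) (Z.mulVec v i))| := by
        rw [gradRem, gradRem, ← mul_sub, ← Finset.sum_sub_distrib, abs_mul,
          abs_of_nonneg (by positivity : (0 : ℝ) ≤ 1 / n)]
        simp only [mul_sub, Z]
    _ ≤ (1 / (n : ℝ)) * ∑ i, |X i j| * (1 / 8 * (|Z.mulVec u i| + |Z.mulVec v i|) *
          |Z.mulVec (u - v) i|) := by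
        gcongr
        refine (Finset.abs_sum_le_sum_abs _ _).trans (Finset.sum_le_sum fun i _ => ?_)
        rw [abs_mul, Matrix.mulVec_sub, Pi.sub_apply]
        exact mul_le_mul_of_nonneg_left (abs_sigmoidRem_sub_le _ _ _) (abs_nonneg _)
    _ = 1 / 8 * ((1 / (n : ℝ)) * ∑ i, |X i j| * (|Z.mulVec u i| * |Z.mulVec (u - v) i|) +
          (1 / (n : ℝ)) * ∑ i, |X i j| * (|Z.mulVec v i| * |Z.mulVec (u - v) i|)) := by
        rw [← mul_add, ← Finset.sum_add_distrib, mul_left_comm, Finset.mul_sum (a := (1 / 8 : ℝ))]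
        congr 1
        exact Finset.sum_congr rfl fun i _ => by ring
    _ ≤ 1 / 8 * (Q₁ X β * (support β).card * (‖u‖ * ‖u - v‖) +
          Q₁ X β * (support β).card * (‖v‖ * ‖u - v‖)) := by gcongr
    _ = _ := by ring

lemma gradRem_zero (X : Matrix (Fin n) (Fin p) ℝ) (β : Fin p → ℝ) (A : Finset (Fin p))
    (j : Fin p) : gradRem X β A 0 j = 0 := by
  simp [gradRem, sigmoidRem_zero]

/-! ### The deterministic part -/

section Deterministic

variable {n p : ℕ} {X : Matrix (Fin n) (Fin p) ℝ} {βstar : Fin p → ℝ} {y : Fin n → ℝ}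

lemma cross_mulVec (X : Matrix (Fin n) (Fin p) ℝ) (β : Fin p → ℝ) (A B : Finset (Fin p))
    (u : A → ℝ) (k : B) :
    ((cols X B).transpose * sigmaMat X β * cols X A).mulVec u k =
      ∑ i, X i k * (deriv (deriv psi) (X.mulVec β i) * (cols X A).mulVec u i) := by
  rw [← Matrix.mulVec_mulVec, ← Matrix.mulVec_mulVec, Matrix.mulVec, dotProduct]
  refine Finset.sum_congr rfl fun i _ => ?_
  rw [sigmaMat, Matrix.mulVec_diagonal]
  rfl

/-- Near `βstar` there is a vector supported in its support whose gradient vanishes on the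
support and is small elsewhere. -/
lemma exists_stationary (hn : 0 < n) (hX : IsUnit (gramA X βstar)) {t c : ℝ} (ht : 0 < t)
    (htQ : Q₁ X βstar * Q₂ X βstar ^ 2 * (support βstar).card * t ≤ 1)
    (htc : t * (1 + 2 * Q₃ X βstar) ≤ c / 2)
    (hgA : ∀ j ∈ support βstar, |grad X y βstar j| ≤ t)
    (hgAc : ∀ j, j ∉ support βstar → |grad X y βstar j| ≤ c / 2) :
    ∃ u : support βstar → ℝ, ‖u‖ ≤ 2 * Q₂ X βstar * t ∧
      (∀ j ∈ support βstar, grad X y (βstar + extendZero _ u) j = 0) ∧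
      ∀ j, j ∉ support βstar → |grad X y (βstar + extendZero _ u) j| < c := by
  have hn' : (0 : ℝ) < n := by exact_mod_cast hn
  have hQ₁ : 0 ≤ Q₁ X βstar := Q₁_nonneg X βstar
  have hQ₂ : 0 ≤ Q₂ X βstar := linftyNorm_nonneg _
  have hQ₃ : 0 ≤ Q₃ X βstar := linftyNorm_nonneg _
  have hdet := (Matrix.isUnit_iff_isUnit_det _).1 hX
  have hH : IsUnit ((1 / (n : ℝ)) • gramA X βstar) := by
    rw [Matrix.isUnit_iff_isUnit_det, Matrix.det_smul]
    exact (IsUnit.mk0 _ (by positivity)).mul hdet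
  obtain ⟨u, hu, hroot⟩ := exists_small_root hH
    (g := fun k => grad X y βstar k) (R := fun u k => gradRem X βstar (support βstar) u k)
    -- `L` is the constant of `abs_gradRem_sub_le` with `‖u‖ + ‖v‖ ≤ 4 * Q₂ * t`; the condition on
    -- `Q₂ * L` is then exactly `htQ`.
    (t := t) (L := 1 / 2 * (Q₁ X βstar * (support βstar).card) * (Q₂ X βstar * t))
    ht.le (fun k => hgA k k.2) (funext fun k => gradRem_zero X βstar _ k)
    (by change Q₂ X βstar * _ ≤ _; nlinarith) (by positivity)
    (fun u v hu hv k => by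
      change ‖u‖ ≤ 2 * Q₂ X βstar * t at hu
      change ‖v‖ ≤ 2 * Q₂ X βstar * t at hv
      refine (abs_gradRem_sub_le X βstar k u v).trans ?_
      refine mul_le_mul_of_nonneg_right ?_ (norm_nonneg _)
      have h := mul_le_mul_of_nonneg_left (add_le_add hu hv)
        (by positivity : 0 ≤ 1 / 8 * (Q₁ X βstar * (support βstar).card))
      linarith)
  change ‖u‖ ≤ 2 * Q₂ X βstar * t at hu
  have hrem : ∀ j, |gradRem X βstar (support βstar) u j| ≤ t / 2 := fun j => by
    have h := abs_gradRem_sub_le X βstar j u 0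
    rw [gradRem_zero, sub_zero, sub_zero, norm_zero, add_zero] at h
    calc _ ≤ _ := h
      _ ≤ 1 / 8 * (Q₁ X βstar * (support βstar).card) * (2 * Q₂ X βstar * t) *
          (2 * Q₂ X βstar * t) := by gcongr
      _ = Q₁ X βstar * Q₂ X βstar ^ 2 * (support βstar).card * t * (t / 2) := by ring
      _ ≤ 1 * (t / 2) := by gcongr
      _ = t / 2 := one_mul _
  refine ⟨u, hu, fun j hj => ?_, fun j hj => ?_⟩
  · have h := congrFun hroot ⟨j, hj⟩
    rw [grad_add_extendZero, ← cross_mulVec X βstar _ (support βstar) u ⟨j, hj⟩]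
    simpa [Matrix.smul_mulVec, gramA] using h
  · have hjc : j ∈ (support βstar)ᶜ := Finset.mem_compl.2 hj
    rw [grad_add_extendZero, ← cross_mulVec X βstar _ (support βstar)ᶜ u ⟨j, hjc⟩]
    have hHu : ∀ k, |((1 / (n : ℝ)) • gramA X βstar).mulVec u k| ≤ 3 / 2 * t := fun k => by
      have h := congrFun hroot k
      simp only [Pi.add_apply, Pi.zero_apply] at h
      have h1 := abs_le.1 (hgA k k.2)
      have h2 := abs_le.1 (hrem k)
      rw [abs_le]
      constructor <;> linarith [h1.1, h1.2, h2.1, h2.2]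
    -- The off-support Hessian block applied to `u` is the matrix of `Q₃` applied to `H u`, and `|H
    -- u| ≤ 3/2 * t` by the root equation. The total is at most `c/2 + 3/2 * Q₃ * t + t/2`, which is
    -- below `c` by `htc` and `0 < t`.
    have h3 := abs_mulVec_le_linftyNorm ((cols X (support βstar)ᶜ).transpose * sigmaMat X βstar *
      cols X (support βstar) * (gramA X βstar)⁻¹) (by positivity) hHu ⟨j, hjc⟩
    rw [Matrix.mulVec_mulVec, Matrix.mul_smul, Matrix.mul_assoc, Matrix.nonsing_inv_mul _ hdet,
      Matrix.mul_one, Matrix.smul_mulVec, Pi.smul_apply, smul_eq_mul] at h3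
    change _ ≤ Q₃ X βstar * _ at h3
    have h1 := abs_le.1 (hgAc j hj)
    have h2 := abs_le.1 (hrem j)
    have h3 := abs_le.1 h3
    have h4 : 0 ≤ Q₃ X βstar * t := by positivity
    rw [abs_lt]
    constructor <;> linarith [h1.1, h1.2, h2.1, h2.2, h3.1, h3.2]

variable {a₁ a₂ a lam : ℝ} {P : ℝ → ℝ}

lemma IsFoldedConcavePenalty.le_penaltyDeriv (hP : IsFoldedConcavePenalty a₁ a₂ a lam P) {t : ℝ}
    (h0 : 0 ≤ t) (ht : t ≤ a₂ * lam) : a₁ * lam ≤ penaltyDeriv P t := by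
  rcases h0.eq_or_lt with rfl | h0
  · exact hP.le_deriv_zero
  · exact hP.le_deriv t h0 ht

lemma llaConvergesToOracle_of_bounds (hn : 0 < n) (hX : IsUnit (gramA X βstar)) (hlam : 0 < lam)
    (hP : IsFoldedConcavePenalty a₁ a₂ a lam P)
    (hA0 : ∀ j ∈ support βstar, (a + 1) * lam < |βstar j|)
    {init : Fin p → ℝ} (hinit : ‖init - βstar‖ ≤ min 1 a₂ * lam) {t : ℝ} (ht : 0 < t)
    (htQ : Q₁ X βstar * Q₂ X βstar ^ 2 * (support βstar).card * t ≤ 1)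
    (htc : t * (1 + 2 * Q₃ X βstar) ≤ a₁ * lam / 2)
    (htmin : ∀ j ∈ support βstar, a * lam + 2 * Q₂ X βstar * t ≤ |βstar j|)
    (hgA : ∀ j ∈ support βstar, |grad X y βstar j| ≤ t)
    (hgAc : ∀ j, j ∉ support βstar → |grad X y βstar j| ≤ a₁ * lam / 2) :
    LLAConvergesToOracle (logisticLoss X y) P (support βstar) init := by
  obtain ⟨u, hu, hb0, hbc⟩ := exists_stationary hn hX ht htQ htc hgA hgAc
  set b := βstar + extendZero _ u with hb
  have hβ0 : ∀ j, j ∉ support βstar → βstar j = 0 := fun j hj => by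
    simpa [support] using hj
  have hbsupp : ∀ j, j ∉ support βstar → b j = 0 := fun j hj => by
    simp [hb, hβ0 j hj, extendZero, hj]
  have hmin := fun (w : Fin p → ℝ) (hw : ∀ j ∈ support βstar, w j = 0)
    (hgw : ∀ j, j ∉ support βstar → |grad X y b j| < w j) (β : Fin p → ℝ) (hβ : β ≠ b) =>
    weightedObjective_lt hn hX y hbsupp hb0 hw hgw hβ
  have hinit' : ∀ j, |init j - βstar j| ≤ min 1 a₂ * lam := fun j =>
    (norm_le_pi_norm (init - βstar) j).trans hinit
  have hmin1 : min 1 a₂ * lam ≤ lam := by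
    simpa using mul_le_mul_of_nonneg_right (min_le_left 1 a₂) hlam.le
  have hmin2 : min 1 a₂ * lam ≤ a₂ * lam := mul_le_mul_of_nonneg_right (min_le_right 1 a₂) hlam.le
  -- the criteria with the weights at `init` and at `b` are uniquely minimized by `b`
  have hweights : ∀ z : Fin p → ℝ, (∀ j ∈ support βstar, a * lam ≤ |z j|) →
      (∀ j, j ∉ support βstar → |z j| ≤ a₂ * lam) → ∀ β, β ≠ b →
      weightedObjective (logisticLoss X y) (fun j => penaltyDeriv P |z j|) b <
        weightedObjective (logisticLoss X y) (fun j => penaltyDeriv P |z j|) β :=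
    fun z hz1 hz2 => hmin _ (fun j hj => hP.deriv_eq_zero _ (hz1 j hj))
      fun j hj => (hbc j hj).trans_le (hP.le_penaltyDeriv (abs_nonneg _) (hz2 j hj))
  have hw0 := hweights init
    (fun j hj => by
      have h1 := hA0 j hj
      have h2 := abs_sub_abs_le_abs_sub (βstar j) (init j)
      rw [abs_sub_comm] at h2
      linarith [hinit' j])
    (fun j hj => by
      have h := hinit' j
      rw [hβ0 j hj, sub_zero] at h
      exact h.trans hmin2)
  have hwb := hweights b
    (fun j hj => by
      have h1 := htmin j hj
      have h2 := abs_sub_abs_le_abs_sub (βstar j) (b j)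
      have h3 : |βstar j - b j| ≤ ‖u‖ := by
        simpa [hb, extendZero, hj] using norm_le_pi_norm u ⟨j, hj⟩
      linarith)
    (fun j hj => by
      rw [hbsupp j hj, abs_zero]
      have := hP.a₂_pos
      positivity)
  have hmin_or : ∀ β : Fin p → ℝ, (∀ j, j ∉ support βstar → β j = 0) → β ≠ b →
      logisticLoss X y b < logisticLoss X y β := fun β hβ hne => by
    -- Any admissible weights do here: they contribute nothing on vectors supported in the support,
    -- so the penalized comparison becomes one of losses.
    have h := hmin (fun j => if j ∈ support βstar then 0 else |grad X y b j| + 1)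
      (fun j hj => by simp [hj]) (fun j hj => by simp [hj]) β hne
    have hz : ∀ v : Fin p → ℝ, (∀ j, j ∉ support βstar → v j = 0) →
        ∑ j, (if j ∈ support βstar then 0 else |grad X y b j| + 1) * |v j| = 0 := fun v hv =>
      Finset.sum_eq_zero fun j _ => by
        by_cases hj : j ∈ support βstar
        · simp [hj]
        · simp [hv j hj]
    unfold weightedObjective at h
    rwa [hz β hβ, hz b hbsupp, add_zero, add_zero] at h
  have hle : ∀ {f : (Fin p → ℝ) → ℝ}, (∀ β, β ≠ b → f b < f β) → ∀ β, f b ≤ f β := fun h β => by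
    rcases eq_or_ne β b with rfl | hβ
    · exact le_rfl
    · exact (h β hβ).le
  refine ⟨b, ⟨⟨hbsupp, fun β hβ => ?_⟩, fun b' hb' => ?_⟩, ⟨fun m => if m = 0 then init else b,
    by simp, fun m β => ?_⟩, fun run hrun m hm => ?_⟩
  · rcases eq_or_ne β b with h | h
    · rw [h]
    · exact (hmin_or β hβ h).le
  · by_contra hne
    exact absurd (hb'.2 b hbsupp) (not_le.2 (hmin_or b' hb'.1 hne))
  · rcases m with _ | m
    · exact hle hw0 β
    · exact hle hwb β
  · induction m, hm using Nat.le_induction with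
    | base =>
      by_contra hne
      have h := hrun.2 0 b
      rw [hrun.1] at h
      exact absurd h (not_le.2 (hw0 _ hne))
    | succ m _ ih =>
      by_contra hne
      have h := hrun.2 m b
      rw [ih] at h
      exact absurd h (not_le.2 (hwb _ hne))

end Deterministic

/-! ### Concentration of the gradient -/

section Concentration

variable {Ω : Type*} [MeasurableSpace Ω] {μ : Measure Ω} {n p : ℕ}
  {X : Matrix (Fin n) (Fin p) ℝ} {βstar : Fin p → ℝ} {y : Fin n → Ω → ℝ}

lemma IsLogisticModel.measurable_grad (hy : IsLogisticModel μ X βstar y) (β : Fin p → ℝ) (j : Fin p) :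
    Measurable fun ω => grad X (fun i => y i ω) β j := by
  have := hy.measurable
  unfold grad
  fun_prop

variable [IsProbabilityMeasure μ]

/-- Hoeffding's lemma for a variable in `[0, 1]`; the mean is the success probability. -/
lemma IsLogisticModel.hasSubgaussianMGF (hy : IsLogisticModel μ X βstar y) (i : Fin n) :
    HasSubgaussianMGF (fun ω => y i ω - Real.sigmoid (X.mulVec βstar i)) (1 / 4) μ := by
  have hmem : ∀ᵐ ω ∂μ, y i ω ∈ Set.Icc (0 : ℝ) 1 := by
    have h : ∀ᵐ z ∂(μ.map (y i)), z ∈ Set.Icc (0 : ℝ) 1 := by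
      rw [hy.law i, ae_iff]
      exact bernoulliMeasure_apply_of_notMem_of_notMem _ measurableSet_Icc.compl
        (by simp) (by simp)
    exact ae_of_ae_map (hy.measurable i).aemeasurable h
  have hmean : μ[y i] = Real.sigmoid (X.mulVec βstar i) := by
    have h := integral_map (μ := μ) (hy.measurable i).aemeasurable
      (f := fun z : ℝ => z) measurable_id.aestronglyMeasurable
    rw [← h, hy.law i, integral_bernoulliMeasure, coe_logisticProb]
    simp
  have h := hasSubgaussianMGF_of_mem_Icc (hy.measurable i).aemeasurable hmem
  rw [hmean] at h
  convert h using 1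
  simp
  norm_num

lemma IsLogisticModel.measure_abs_grad_ge_le (hn : 0 < n) (hy : IsLogisticModel μ X βstar y)
    (hM : 0 < colBound X) (j : Fin p) {τ : ℝ} (hτ : 0 < τ) :
    μ.real {ω | τ ≤ |grad X (fun i => y i ω) βstar j|} ≤
      2 * Real.exp (-(n / colBound X * (2 * τ ^ 2))) := by
  have hn' : (0 : ℝ) < n := by exact_mod_cast hn
  set W : Fin n → Ω → ℝ := fun i ω => X i j * (y i ω - Real.sigmoid (X.mulVec βstar i)) with hW
  have hgrad : ∀ ω, (n : ℝ) * grad X (fun i => y i ω) βstar j = -∑ i, W i ω := fun ω => by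
    rw [grad, ← mul_assoc, mul_one_div_cancel hn'.ne', one_mul, ← Finset.sum_neg_distrib]
    exact Finset.sum_congr rfl fun i _ => by simp only [hW]; ring
  have hsub := HasSubgaussianMGF.sum_of_iIndepFun (s := Finset.univ) (X := W)
    (hy.indep.comp (fun i z => X i j * (z - Real.sigmoid (X.mulVec βstar i)))
      fun i => by fun_prop)
    fun i _ => (hy.hasSubgaussianMGF i).const_mul (X i j)
  set c : NNReal := ∑ i : Fin n, (⟨X i j ^ 2, sq_nonneg _⟩ * (1 / 4) : NNReal) with hc
  have hcval : (c : ℝ) = (∑ i, X i j ^ 2) / 4 := by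
    rw [hc, NNReal.coe_sum, Finset.sum_div]
    refine Finset.sum_congr rfl fun i _ => ?_
    change X i j ^ 2 * (1 / 4) = _
    ring
  have hcM : 4 * (c : ℝ) ≤ n * colBound X := by
    have h : (1 / (n : ℝ)) * ∑ i, X i j ^ 2 ≤ colBound X :=
      le_ciSup (f := fun j : Fin p => (1 / (n : ℝ)) * ∑ i, X i j ^ 2) (Finite.bddAbove_range _) j
    rw [hcval, mul_div_cancel₀ _ (by norm_num : (4 : ℝ) ≠ 0)]
    rw [one_div, inv_mul_le_iff₀ hn'] at h
    exact h
  -- A zero variance proxy means a zero column, where the gradient entry vanishes identically; the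
  -- Gaussian tail would divide by zero there.
  rcases c.2.eq_or_lt with h0 | hcpos
  · have hX0 : ∀ i, X i j = 0 := fun i => by
      have h1 : ∑ i, X i j ^ 2 = 0 := by
        change (0 : ℝ) = c at h0
        linarith
      have h2 := (Finset.sum_eq_zero_iff_of_nonneg fun i _ => sq_nonneg (X i j)).1 h1 i
        (Finset.mem_univ i)
      exact pow_eq_zero_iff two_ne_zero |>.1 h2
    have hempty : {ω | τ ≤ |grad X (fun i => y i ω) βstar j|} = ∅ := by
      ext ω
      simp [grad, hX0, hτ]
    rw [hempty, measureReal_empty]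
    positivity
  · change (0 : ℝ) < c at hcpos
    have hexp : Real.exp (-(n * τ) ^ 2 / (2 * c)) ≤
        Real.exp (-(n / colBound X * (2 * τ ^ 2))) := by
      rw [Real.exp_le_exp, neg_div, neg_le_neg_iff, div_mul_eq_mul_div,
        div_le_div_iff₀ hM (by positivity)]
      have := mul_le_mul_of_nonneg_left hcM (by positivity : 0 ≤ n * τ ^ 2)
      linarith
    have h1 := hsub.measure_ge_le (ε := n * τ) (by positivity)
    have h2 := hsub.neg.measure_ge_le (ε := n * τ) (by positivity)
    have hset : {ω | τ ≤ |grad X (fun i => y i ω) βstar j|} ⊆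
        {ω | n * τ ≤ ∑ i, W i ω} ∪ {ω | n * τ ≤ (-fun ω => ∑ i, W i ω) ω} := by
      intro ω hω
      simp only [Set.mem_ofPred_eq] at hω
      have h3 := mul_le_mul_of_nonneg_left hω hn'.le
      rw [← abs_of_pos hn', ← abs_mul, abs_of_pos hn', hgrad, abs_neg] at h3
      exact le_abs.1 h3
    calc _ ≤ _ := measureReal_mono hset
      _ ≤ _ := measureReal_union_le _ _
      _ ≤ _ := by linarith

lemma IsLogisticModel.measure_exists_abs_grad_ge_le (hn : 0 < n)
    (hy : IsLogisticModel μ X βstar y) (hM : 0 < p → 0 < colBound X) (B : Finset (Fin p)) {τ : ℝ}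
    (hτ : 0 < τ) :
    μ.real (⋃ j ∈ B, {ω | τ ≤ |grad X (fun i => y i ω) βstar j|}) ≤
      2 * (B.card : ℝ) * Real.exp (-(n / colBound X * (2 * τ ^ 2))) := by
  refine (measureReal_biUnion_finset_le _ _).trans ?_
  refine (Finset.sum_le_card_nsmul _ _ _ fun j _ =>
    hy.measure_abs_grad_ge_le hn (hM j.pos) j hτ).trans (le_of_eq ?_)
  rw [nsmul_eq_mul]
  ring

end Concentration

/-! ### The probability bound -/

section Bounds

variable {n p : ℕ} {X : Matrix (Fin n) (Fin p) ℝ} {βstar : Fin p → ℝ} {a₁ a lam : ℝ}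

lemma card_support_le (β : Fin p → ℝ) : ((support β).card : ℝ) ≤ p := by
  exact_mod_cast (Finset.card_le_univ _).trans_eq (Fintype.card_fin p)

lemma colBound_nonneg (X : Matrix (Fin n) (Fin p) ℝ) : 0 ≤ colBound X :=
  Real.iSup_nonneg fun j => by positivity

lemma delta₂_nonneg (X : Matrix (Fin n) (Fin p) ℝ) (β : Fin p → ℝ) (a lam : ℝ) :
    0 ≤ delta₂ X β a lam := by
  unfold delta₂
  positivity

lemma one_le_delta₁_of_colBound_eq_zero (hp : 0 < p) (hM : colBound X = 0) :
    1 ≤ delta₁ X βstar a₁ lam := by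
  have : (1 : ℝ) ≤ p := by exact_mod_cast hp
  simp only [delta₁, hM, div_zero, mul_zero, neg_zero, zero_mul, Real.exp_zero, mul_one]
  linarith

/-- With `2 / 0 = 0` the minimum in the first exponent is `0`, so the bound is vacuous and this
degenerate case can be discarded. -/
lemma one_le_delta₁_of_eq_zero (hs : 0 < (support βstar).card) (hQ : Q₁ X βstar * Q₂ X βstar = 0) :
    1 ≤ delta₁ X βstar a₁ lam := by
  have h1 : (1 : ℝ) ≤ (support βstar).card := by exact_mod_cast hs
  have h2 : Q₁ X βstar ^ 2 * Q₂ X βstar ^ 4 * ((support βstar).card : ℝ) ^ 2 = 0 := by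
    rcases mul_eq_zero.1 hQ with h | h <;> simp [h]
  have h3 : min (0 : ℝ) (a₁ ^ 2 * lam ^ 2 / (2 * (1 + 2 * Q₃ X βstar) ^ 2)) = 0 :=
    min_eq_left (by positivity)
  have h4 : 0 ≤ 2 * ((p : ℝ) - ((support βstar).card : ℝ)) *
      Real.exp (-(a₁ ^ 2 * (n : ℝ) * lam ^ 2 / (2 * colBound X))) :=
    mul_nonneg (by linarith [card_support_le βstar]) (Real.exp_pos _).le
  rw [delta₁, h2, div_zero, h3, mul_zero, Real.exp_zero]
  linarith

lemma lt_minSignal {c : ℝ} (hs : (support βstar).Nonempty) (h : ∀ j ∈ support βstar, c < |βstar j|) :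
    c < minSignal βstar := by
  have : Nonempty (support βstar) := hs.to_subtype
  obtain ⟨k, hk⟩ := exists_eq_ciInf_of_finite (f := fun j : support βstar => |βstar j|)
  rw [minSignal, ← hk]
  exact h k k.2

lemma minSignal_le {j : Fin p} (hj : j ∈ support βstar) : minSignal βstar ≤ |βstar j| :=
  ciInf_le (f := fun j : support βstar => |βstar j|) (Finite.bddBelow_range _) ⟨j, hj⟩

/-- A level for the gradient on the support which suffices for the deterministic argument and is
exceeded with a probability controlled by `δ₁` and `δ₂`. -/
lemma exists_threshold (ha₁ : 0 < a₁) (hlam : 0 < lam) (hs : 0 < (support βstar).card →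
      0 < Q₁ X βstar * Q₂ X βstar)
    (hA0 : ∀ j ∈ support βstar, (a + 1) * lam < |βstar j|) :
    ∃ t : ℝ, 0 < t ∧ Q₁ X βstar * Q₂ X βstar ^ 2 * (support βstar).card * t ≤ 1 ∧
      t * (1 + 2 * Q₃ X βstar) ≤ a₁ * lam / 2 ∧
      (∀ j ∈ support βstar, a * lam + 2 * Q₂ X βstar * t ≤ |βstar j|) ∧
      2 * ((support βstar).card : ℝ) * Real.exp (-(n / colBound X * (2 * t ^ 2))) +
        2 * ((p : ℝ) - ((support βstar).card : ℝ)) *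
          Real.exp (-(n / colBound X * (2 * (a₁ * lam / 2) ^ 2))) ≤
        delta₁ X βstar a₁ lam + delta₂ X βstar a lam := by
  have hM := colBound_nonneg X
  have hQ₁ : 0 ≤ Q₁ X βstar := Q₁_nonneg X βstar
  have hQ₂ : 0 ≤ Q₂ X βstar := linftyNorm_nonneg _
  have hQ₃ : 0 ≤ Q₃ X βstar := linftyNorm_nonneg _
  have hexp : n / colBound X * (2 * (a₁ * lam / 2) ^ 2) =
      a₁ ^ 2 * (n : ℝ) * lam ^ 2 / (2 * colBound X) := by
    rcases hM.eq_or_lt with h | h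
    · simp [← h]
    · field_simp
  rw [hexp]
  set τ := a₁ * lam / (2 * (1 + 2 * Q₃ X βstar)) with hτ
  have hτ0 : 0 < τ := by positivity
  have hτQ : τ * (1 + 2 * Q₃ X βstar) = a₁ * lam / 2 := by
    rw [hτ]
    field_simp
  rcases Nat.eq_zero_or_pos (support βstar).card with h0 | hpos
  · have hempty := Finset.card_eq_zero.1 h0
    refine ⟨τ, hτ0, by simp [h0], hτQ.le, by simp [hempty], ?_⟩
    simp [delta₁, delta₂, h0]
  · have hQ := hs hpos
    have hQ₁ : 0 < Q₁ X βstar := pos_of_mul_pos_left hQ hQ₂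
    have hQ₂ : 0 < Q₂ X βstar := pos_of_mul_pos_right hQ hQ₁.le
    have hs' : (0 : ℝ) < (support βstar).card := by exact_mod_cast hpos
    have hsig : 0 < minSignal βstar - a * lam := by
      have := lt_minSignal (Finset.card_pos.1 hpos) hA0
      linarith
    set S : ℝ := ((support βstar).card : ℝ)
    set q₁ := Q₁ X βstar
    set q₂ := Q₂ X βstar
    -- The largest levels allowed by the contraction condition (`t₁`), the gradient off the support
    -- (`τ`) and the signal strength (`t₂`).
    set t₁ := 1 / (q₁ * q₂ ^ 2 * S) with ht₁
    set t₂ := (minSignal βstar - a * lam) / (2 * q₂) with ht₂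
    have ht₁0 : 0 < t₁ := by positivity
    have ht₂0 : 0 < t₂ := by positivity
    have hle1 : min (min t₁ τ) t₂ ≤ t₁ := (min_le_left _ _).trans (min_le_left _ _)
    have hleτ : min (min t₁ τ) t₂ ≤ τ := (min_le_left _ _).trans (min_le_right _ _)
    have hle2 : min (min t₁ τ) t₂ ≤ t₂ := min_le_right _ _
    refine ⟨min (min t₁ τ) t₂, by positivity, ?_, ?_, fun j hj => ?_, ?_⟩
    · rw [ht₁, le_div_iff₀ (by positivity)] at hle1
      linarith
    · rw [← hτQ]
      gcongr
    · rw [ht₂, le_div_iff₀ (by positivity)] at hle2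
      linarith [minSignal_le hj]
    -- The tail at the minimum is the tail at one of the three levels: `t₁` and `τ` are paid for by
    -- `δ₁`, and `t₂` by the signal term of `δ₂`.
    · have key : Real.exp (-(n / colBound X * (2 * (min (min t₁ τ) t₂) ^ 2))) ≤
          Real.exp (-((n : ℝ) / colBound X) * min (2 / (q₁ ^ 2 * q₂ ^ 4 * S ^ 2))
            (a₁ ^ 2 * lam ^ 2 / (2 * (1 + 2 * Q₃ X βstar) ^ 2))) +
          Real.exp (-((n : ℝ) / (colBound X * q₂ ^ 2)) * min (2 / (q₁ ^ 2 * q₂ ^ 2 * S ^ 2))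
            (1 / 2 * (minSignal βstar - a * lam) ^ 2)) := by
        have e1 : 2 * t₁ ^ 2 = 2 / (q₁ ^ 2 * q₂ ^ 4 * S ^ 2) := by
          rw [ht₁]
          field_simp
        have e2 : 2 * τ ^ 2 = a₁ ^ 2 * lam ^ 2 / (2 * (1 + 2 * Q₃ X βstar) ^ 2) := by
          rw [hτ]
          field_simp
        have e3 : 2 * t₂ ^ 2 = 1 / q₂ ^ 2 * (1 / 2 * (minSignal βstar - a * lam) ^ 2) := by
          rw [ht₂]
          field_simp
        have e4 : (n : ℝ) / (colBound X * q₂ ^ 2) = n / colBound X * (1 / q₂ ^ 2) := by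
          rw [div_mul_div_comm, mul_one]
        have hnM : 0 ≤ (n : ℝ) / colBound X := by positivity
        rcases min_choice (min t₁ τ) t₂ with h | h
        · refine le_add_of_le_of_nonneg (Real.exp_le_exp.2 ?_) (Real.exp_pos _).le
          rw [neg_mul, neg_le_neg_iff, h]
          refine mul_le_mul_of_nonneg_left ?_ hnM
          rcases min_choice t₁ τ with h' | h' <;> rw [h']
          · exact (min_le_left _ _).trans_eq e1.symm
          · exact (min_le_right _ _).trans_eq e2.symm
        · refine le_add_of_nonneg_of_le (Real.exp_pos _).le (Real.exp_le_exp.2 ?_)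
          rw [neg_mul, neg_le_neg_iff, h, e3, e4, mul_assoc]
          gcongr
          exact min_le_right _ _
      have h2 := mul_le_mul_of_nonneg_left key (by positivity : 0 ≤ 2 * S)
      rw [delta₁, delta₂]
      linarith

end Bounds

end LLALogistic

theorem theorem4 {Ω : Type*} [MeasurableSpace Ω] (μ : Measure Ω) [IsProbabilityMeasure μ]
    {n p : ℕ} (hn : 0 < n) (X : Matrix (Fin n) (Fin p) ℝ) (βstar : Fin p → ℝ)
    (y : Fin n → Ω → ℝ) (hy : LLALogistic.IsLogisticModel μ X βstar y)
    (hX : IsUnit (LLALogistic.gramA X βstar))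
    (a₁ a₂ a lam : ℝ) (hlam : 0 < lam) (P : ℝ → ℝ)
    (hP : LLALogistic.IsFoldedConcavePenalty a₁ a₂ a lam P)
    (hA0 : ∀ j ∈ LLALogistic.support βstar, (a + 1) * lam < |βstar j|)
    (init : Ω → Fin p → ℝ) (hinit : Measurable init) :
    ∃ G : Set Ω, MeasurableSet G ∧
      1 - μ.real {ω | min 1 a₂ * lam < ‖init ω - βstar‖}
        - LLALogistic.delta₁ X βstar a₁ lam - LLALogistic.delta₂ X βstar a lam ≤ μ.real G ∧
      ∀ ω ∈ G, LLALogistic.LLAConvergesToOracle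
        (LLALogistic.logisticLoss X (fun i => y i ω)) P
        (LLALogistic.support βstar) (init ω) := by
  set B₀ := {ω | min 1 a₂ * lam < ‖init ω - βstar‖} with hB₀
  -- If `δ₁ ≥ 1` the empty event suffices. Otherwise the degenerate values `colBound X = 0` (when `0
  -- < p`) and `Q₁ * Q₂ = 0` (when the support is nonempty) are excluded.
  by_cases htriv : 1 ≤ LLALogistic.delta₁ X βstar a₁ lam
  · refine ⟨∅, MeasurableSet.empty, ?_, by simp⟩
    have := LLALogistic.delta₂_nonneg X βstar a lam
    have : 0 ≤ μ.real B₀ := measureReal_nonneg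
    rw [measureReal_empty]
    linarith
  have hM : 0 < p → 0 < LLALogistic.colBound X := fun hp =>
    (LLALogistic.colBound_nonneg X).lt_of_ne fun h =>
      htriv (LLALogistic.one_le_delta₁_of_colBound_eq_zero hp h.symm)
  have hQ : 0 < (LLALogistic.support βstar).card →
      0 < LLALogistic.Q₁ X βstar * LLALogistic.Q₂ X βstar := fun hs =>
    (mul_nonneg (LLALogistic.Q₁_nonneg X βstar) (LLALogistic.linftyNorm_nonneg _)).lt_of_ne
      fun h => htriv (LLALogistic.one_le_delta₁_of_eq_zero hs h.symm)
  obtain ⟨t, ht, htQ, htc, htmin, hbound⟩ :=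
    LLALogistic.exists_threshold hP.a₁_pos hlam hQ hA0
  set B₁ := ⋃ j ∈ LLALogistic.support βstar,
    {ω | t ≤ |LLALogistic.grad X (fun i => y i ω) βstar j|} with hB₁
  set B₂ := ⋃ j ∈ (LLALogistic.support βstar)ᶜ,
    {ω | a₁ * lam / 2 ≤ |LLALogistic.grad X (fun i => y i ω) βstar j|} with hB₂
  have hτ : 0 < a₁ * lam / 2 := by
    have := hP.a₁_pos
    positivity
  have hmeas : ∀ (B : Finset (Fin p)) (c : ℝ), MeasurableSet
      (⋃ j ∈ B, {ω | c ≤ |LLALogistic.grad X (fun i => y i ω) βstar j|}) := fun B c =>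
    B.measurableSet_biUnion fun j _ =>
      measurableSet_le measurable_const (hy.measurable_grad βstar j).abs
  have hB : MeasurableSet (B₀ ∪ B₁ ∪ B₂) :=
    ((measurableSet_lt measurable_const (hinit.sub_const βstar).norm).union
      (hmeas _ _)).union (hmeas _ _)
  refine ⟨(B₀ ∪ B₁ ∪ B₂)ᶜ, hB.compl, ?_, fun ω hω => ?_⟩
  · have h1 := hy.measure_exists_abs_grad_ge_le hn hM (LLALogistic.support βstar) ht
    have h2 := hy.measure_exists_abs_grad_ge_le hn hM (LLALogistic.support βstar)ᶜ hτ
    rw [Finset.card_compl, Fintype.card_fin,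
      Nat.cast_sub ((Finset.card_le_univ _).trans_eq (Fintype.card_fin p))] at h2
    have h3 : μ.real (B₀ ∪ B₁ ∪ B₂) ≤ μ.real B₀ + μ.real B₁ + μ.real B₂ :=
      (measureReal_union_le _ _).trans (add_le_add_left (measureReal_union_le _ _) _)
    rw [probReal_compl_eq_one_sub hB]
    linarith
  · simp only [hB₀, hB₁, hB₂, Set.compl_union, Set.mem_inter_iff, Set.mem_compl_iff,
      Set.mem_ofPred_eq, Set.mem_iUnion, not_exists, not_lt, not_le] at hω
    obtain ⟨⟨h0, h1⟩, h2⟩ := hω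
    exact LLALogistic.llaConvergesToOracle_of_bounds hn hX hlam hP hA0 h0 ht htQ htc htmin
      (fun j hj => (h1 j hj).le) (fun j hj => (h2 j (Finset.mem_compl.2 hj)).le)
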